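/- Let $\mathcal H,\mathcal H_1,\dots,\mathcal H_n$ be finite-dimensional complex Hilbert spaces, $N=\{1,\dots,n\}$, and $\mathcal H_X=\bigotimes_{i\in X}\mathcal H_i$ for $X\subseteq N$. Write $\mathcal S(\mathcal J)$ for the set of density operators and $\mathcal S_1(\mathcal J)$ for the set of pure states on a Hilbert space $\mathcal J$; a quantum operation is a completely positive trace-preserving linear map. A quantum operation $\mathcal E:\mathcal S(\mathcal J)\to\mathcal S(\mathcal K)$ is called reversible if there is a quantum operation $\mathcal R:\mathcal S(\mathcal K)\to\mathcal S(\mathcal J)$ with $\mathcal R(\mathcal E(\rho))=\rho$ for all $\rho\in\mathcal S(\mathcal J)$, and vanishing if there is $\rho_0\in\mathcal S(\mathcal K)$ with $\mathcal E(\rho)=\rho_0$ for all $\rho\in\mathcal S(\mathcal J)$. A quantum secret sharing (QSS) scheme is a reversible quantum operation $W_N:\mathcal S(\mathcal H)\to\mathcal S(\mathcal H_N)$. For $X\subseteq N$ put $W_X=\operatorname{Tr}_{N\setminus X}\circ W_N$ and $W_i=W_{\{i\}}$; the set $X$ is called qualified if $W_X$ is reversible, and forbidden if $W_X$ is vanishing.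 For integers $k\ge 0$ and $L\ge 1$, the scheme $W_N$ is a $(k,L,n)$-threshold ramp QSS scheme if, for every $X\subseteq N$, $X$ is forbidden iff $|X|\le k-L$, and $X$ is qualified iff $|X|\ge k$. Theorem. Let $W_N$ be a $(k,L,n)$-threshold ramp QSS scheme, and let $\mu$ be a Borel probability measure on $\mathcal S_1(\mathcal H)$ with $\mu(O)>0$ for every nonempty relatively open set $O\subseteq\mathcal S_1(\mathcal H)$. Let $\sigma_\mu=\int\rho\,\mu(d\rho)$, and let $H(\rho)=-\operatorname{Tr}\rho\log\rho$ denote the von Neumann entropy. Then $$\frac1L\,H(\sigma_\mu)\le\frac1n\sum_{i=1}^n H\bigl(W_i(\sigma_\mu)\bigr).$$ -/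

import Mathlib

open scoped ComplexOrder

noncomputable section

namespace QSS

/-! The finite-dimensional Hilbert space with orthonormal basis indexed by a finite type `a`
is `ℂ^a`, and its linear operators are the matrices `Matrix a a ℂ`. -/

section Operations

variable {a b : Type*} [Fintype a] [Fintype b]

/-- Density operators: positive semidefinite operators of trace one. -/
def densityOperators (a : Type*) [Fintype a] : Set (Matrix a a ℂ) :=
  {ρ | ρ.PosSemidef ∧ ρ.trace = 1}

/-- Pure states: the projections `|ψ⟩⟨ψ|` onto unit vectors `ψ`. -/
def pureStates (a : Type*) [Fintype a] : Set (Matrix a a ℂ) :=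
  {ρ | ∃ ψ : a → ℂ, star ψ ⬝ᵥ ψ = 1 ∧ ρ = Matrix.vecMulVec ψ (star ψ)}

/-- The set of pure states carries the Borel σ-algebra of its relative topology. -/
instance : MeasurableSpace (pureStates a) := borel _

instance : BorelSpace (pureStates a) := ⟨rfl⟩

/-- The operator `(id_m ⊗ E)(M)`: the map `E` is applied to each of the `m × m` blocks of `M`. -/
def ampliation (E : Matrix a a ℂ →ₗ[ℂ] Matrix b b ℂ) (m : ℕ)
    (M : Matrix (Fin m × a) (Fin m × a) ℂ) : Matrix (Fin m × b) (Fin m × b) ℂ :=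
  Matrix.of fun p q => E (Matrix.of fun i j => M (p.1, i) (q.1, j)) p.2 q.2

/-- Quantum operations: completely positive and trace preserving linear maps. -/
structure IsQuantumOperation (E : Matrix a a ℂ →ₗ[ℂ] Matrix b b ℂ) : Prop where
  completelyPositive : ∀ (m : ℕ) (M : Matrix (Fin m × a) (Fin m × a) ℂ),
    M.PosSemidef → (ampliation E m M).PosSemidef
  tracePreserving : ∀ A : Matrix a a ℂ, (E A).trace = A.trace

/-- `E` is reversible with respect to a set `S` of states: some quantum operation `R`
recovers every state of `S`. -/
def Reversible (E : Matrix a a ℂ →ₗ[ℂ] Matrix b b ℂ) (S : Set (Matrix a a ℂ)) : Prop :=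
  ∃ R : Matrix b b ℂ →ₗ[ℂ] Matrix a a ℂ, IsQuantumOperation R ∧ ∀ ρ ∈ S, R (E ρ) = ρ

/-- `E` is vanishing with respect to a set `S` of states: it sends all states of `S`
to one and the same state. -/
def Vanishing (E : Matrix a a ℂ →ₗ[ℂ] Matrix b b ℂ) (S : Set (Matrix a a ℂ)) : Prop :=
  ∃ ρ₀ ∈ densityOperators b, ∀ ρ ∈ S, E ρ = ρ₀

/-- Von Neumann entropy `H(ρ) = -Tr ρ log ρ`, with the logarithm taken by functional calculus
(and `0 log 0 = 0`, since `Real.log 0 = 0`). -/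
def entropy [DecidableEq a] (ρ : Matrix a a ℂ) : ℝ :=
  -((ρ * cfc Real.log ρ).trace).re

/-- The average state `σ_μ = ∫ ρ μ(dρ)` of an ensemble of pure states, entry by entry. -/
def averageState (μ : MeasureTheory.Measure (pureStates a)) : Matrix a a ℂ :=
  Matrix.of fun i j => ∫ ρ : pureStates a, (ρ : Matrix a a ℂ) i j ∂μ

end Operations

section Schemes

variable {a : Type*} [Fintype a] {n : ℕ} {d : Fin n → Type*} [∀ i, Fintype (d i)]

/-- Index set of the product basis of `H_X = ⨂_{i ∈ X} H_i`, where `H_i = ℂ^(d i)`. -/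
abbrev ShareIndex (d : Fin n → Type*) (X : Finset (Fin n)) : Type _ :=
  ∀ i : {i // i ∈ X}, d i

/-- The partial trace `Tr_{N \ X}` from operators on `H_N` to operators on `H_X`. -/
def partialTrace (d : Fin n → Type*) [∀ i, Fintype (d i)] (X : Finset (Fin n)) :
    Matrix (∀ i, d i) (∀ i, d i) ℂ →ₗ[ℂ] Matrix (ShareIndex d X) (ShareIndex d X) ℂ where
  toFun A := Matrix.of fun x y => ∑ z : (∀ i : {i // i ∉ X}, d i),
    A ((Equiv.piEquivPiSubtypeProd (· ∈ X) d).symm (x, z))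
      ((Equiv.piEquivPiSubtypeProd (· ∈ X) d).symm (y, z))
  map_add' A B := by
    ext x y
    simp [Finset.sum_add_distrib]
  map_smul' c A := by
    ext x y
    simp [Finset.mul_sum]

/-- `W_X = Tr_{N \ X} ∘ W_N`. -/
def marginal (W : Matrix a a ℂ →ₗ[ℂ] Matrix (∀ i, d i) (∀ i, d i) ℂ) (X : Finset (Fin n)) :
    Matrix a a ℂ →ₗ[ℂ] Matrix (ShareIndex d X) (ShareIndex d X) ℂ :=
  partialTrace d X ∘ₗ W

/-- A quantum secret sharing scheme: a quantum operation `W_N` that is reversible with respect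
to all states. -/
structure IsScheme (W : Matrix a a ℂ →ₗ[ℂ] Matrix (∀ i, d i) (∀ i, d i) ℂ) : Prop where
  isQuantumOperation : IsQuantumOperation W
  reversible : Reversible W (densityOperators a)

/-- `X` is qualified if `W_X` is reversible with respect to all states. -/
def Qualified (W : Matrix a a ℂ →ₗ[ℂ] Matrix (∀ i, d i) (∀ i, d i) ℂ)
    (X : Finset (Fin n)) : Prop :=
  Reversible (marginal W X) (densityOperators a)

/-- `X` is forbidden if `W_X` is vanishing with respect to all states. -/
def Forbidden (W : Matrix a a ℂ →ₗ[ℂ] Matrix (∀ i, d i) (∀ i, d i) ℂ)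
    (X : Finset (Fin n)) : Prop :=
  Vanishing (marginal W X) (densityOperators a)

/-- `(k, L, n)`-threshold ramp quantum secret sharing schemes. -/
structure IsRampScheme (k L : ℕ)
    (W : Matrix a a ℂ →ₗ[ℂ] Matrix (∀ i, d i) (∀ i, d i) ℂ) : Prop extends IsScheme W where
  forbidden_iff : ∀ X : Finset (Fin n), Forbidden W X ↔ (X.card : ℤ) ≤ (k : ℤ) - (L : ℤ)
  qualified_iff : ∀ X : Finset (Fin n), Qualified W X ↔ k ≤ X.card

end Schemes

end QSS

end

set_option linter.unusedSectionVars false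

noncomputable section

namespace QSS

open scoped ComplexOrder Kronecker
open Matrix Real

/-! ### Spectral properties of the entropy. -/

section Entropy

variable {a b : Type*} [Fintype a] [DecidableEq a] [Fintype b] [DecidableEq b]

/-! Let σ be the average state and let X be forbidden, X ∪ Y qualified, X and Y disjoint. Dilate the
channel to X ∪ Y by an environment E. Since X ∪ Y recovers the secret, the Knill–Laflamme condition
makes E independent of it, and H(XY) = H(σ) + H(E). Since X carries no information, the same
condition holds with X as the environment of YE, so H(YE) = H(σ) + H(X). Subadditivity gives H(XY) ≤
H(X) + H(Y) and H(YE) ≤ H(Y) + H(E); adding, H(σ) ≤ H(Y). This is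
`entropy_le_of_reversible_of_vanishing`, resting on `Reversible.exists_conjTranspose_mul_eq_smul`,
`entropy_krausMap` and `entropy_le_add`.

Any L shares Y extend a forbidden set of k - L shares to a qualified set of k, so by subadditivity
again H(σ) is at most the sum of the share entropies over Y. Averaging over the cyclic translates of
one L-set gives the theorem. -/

open scoped MatrixOrder Matrix.Norms.L2Operator in
lemma exists_eq_mul_conjTranspose {ρ : Matrix a a ℂ} (h : ρ.PosSemidef) :
    ∃ S : Matrix a a ℂ, ρ = S * Sᴴ := by
  obtain ⟨S, hS⟩ := CStarAlgebra.nonneg_iff_eq_mul_star_self.mp h.nonneg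
  exact ⟨S, hS⟩

lemma entropy_eq_sum_eigenvalues {ρ : Matrix a a ℂ} (h : ρ.IsHermitian) :
    entropy ρ = ∑ i, negMulLog (h.eigenvalues i) := by
  have h1 : cfc Real.log ρ = h.cfc Real.log := h.cfc_eq _
  have h2 : ρ * cfc Real.log ρ = Unitary.conjStarAlgAut ℂ _ h.eigenvectorUnitary
      (diagonal fun i => ((h.eigenvalues i * Real.log (h.eigenvalues i) : ℝ) : ℂ)) := by
    rw [h1, IsHermitian.cfc]
    nth_rw 1 [h.spectral_theorem]
    rw [← map_mul, diagonal_mul_diagonal]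
    congr 2
    ext i
    simp
  rw [entropy, h2, Unitary.conjStarAlgAut_apply, trace_mul_cycle]
  simp [trace_diagonal, negMulLog, ← Finset.sum_neg_distrib]

/-- Makes the entropy a function of the characteristic polynomial, so invariances follow from
polynomial identities. -/
lemma entropy_eq_sum_roots {ρ : Matrix a a ℂ} (h : ρ.IsHermitian) :
    entropy ρ = (ρ.charpoly.roots.map fun z => negMulLog z.re).sum := by
  rw [entropy_eq_sum_eigenvalues h, h.roots_charpoly_eq_eigenvalues, Multiset.map_map]
  rfl

lemma entropy_eq_of_charpoly_eq {ρ σ : Matrix a a ℂ} (hρ : ρ.IsHermitian) (hσ : σ.IsHermitian)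
    (h : ρ.charpoly = σ.charpoly) : entropy ρ = entropy σ := by
  rw [entropy_eq_sum_roots hρ, entropy_eq_sum_roots hσ, h]

lemma entropy_transpose {ρ : Matrix a a ℂ} (hρ : ρ.IsHermitian) :
    entropy ρᵀ = entropy ρ :=
  entropy_eq_of_charpoly_eq hρ.transpose hρ ρ.charpoly_transpose

lemma entropy_reindex (e : a ≃ b) {ρ : Matrix a a ℂ} (hρ : ρ.IsHermitian) :
    entropy (reindex e e ρ) = entropy ρ := by
  rw [entropy_eq_sum_roots hρ, entropy_eq_sum_roots, charpoly_reindex]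
  exact hρ.submatrix _

lemma isHermitian_diagonal_ofReal (p : a → ℝ) :
    (diagonal fun i => (p i : ℂ)).IsHermitian := by
  rw [isHermitian_diagonal_iff]
  intro i
  simp [isSelfAdjoint_iff]

lemma entropy_diagonal (p : a → ℝ) :
    entropy (diagonal fun i => (p i : ℂ)) = ∑ i, negMulLog (p i) := by
  rw [entropy_eq_sum_roots (isHermitian_diagonal_ofReal p), charpoly_diagonal,
    Polynomial.roots_prod]
  · simp only [Polynomial.roots_X_sub_C, Multiset.bind_singleton, Multiset.map_map]
    rfl
  · simp [Finset.prod_ne_zero_iff, Polynomial.X_sub_C_ne_zero]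

lemma entropy_conj {U ρ : Matrix a a ℂ} (hU : Uᴴ * U = 1) (hρ : ρ.IsHermitian) :
    entropy (U * ρ * Uᴴ) = entropy ρ := by
  refine entropy_eq_of_charpoly_eq (isHermitian_mul_mul_conjTranspose U hρ) hρ ?_
  rw [charpoly_mul_comm, ← mul_assoc, hU, one_mul]

/-- Both products have the same nonzero eigenvalues with multiplicity, and surplus zeros contribute
nothing. This replaces the Schmidt decomposition of a pure state. -/
lemma entropy_mul_conjTranspose (M : Matrix a b ℂ) : entropy (M * Mᴴ) = entropy (Mᴴ * M) := by
  rw [entropy_eq_sum_roots (isHermitian_mul_conjTranspose_self M),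
    entropy_eq_sum_roots (isHermitian_conjTranspose_mul_self M)]
  have h := congr_arg Polynomial.roots (charpoly_mul_comm' M Mᴴ)
  rw [Polynomial.roots_mul, Polynomial.roots_mul] at h
  · have h' := congr_arg (fun s : Multiset ℂ => (s.map fun z => negMulLog z.re).sum) h
    simpa [Multiset.map_nsmul, Multiset.sum_nsmul] using h'
  · exact mul_ne_zero (pow_ne_zero _ Polynomial.X_ne_zero) (charpoly_monic _).ne_zero
  · exact mul_ne_zero (pow_ne_zero _ Polynomial.X_ne_zero) (charpoly_monic _).ne_zero

lemma exists_unitary_diagonalization {ρ : Matrix a a ℂ} (h : ρ.PosSemidef) :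
    ∃ (U : Matrix a a ℂ) (p : a → ℝ), Uᴴ * U = 1 ∧ U * Uᴴ = 1 ∧ (∀ i, 0 ≤ p i) ∧
      ρ = U * diagonal (fun i => (p i : ℂ)) * Uᴴ :=
  ⟨h.1.eigenvectorUnitary, h.1.eigenvalues, Unitary.coe_star_mul_self _,
    Unitary.coe_mul_star_self _, h.eigenvalues_nonneg, h.1.spectral_theorem⟩

lemma sum_eq_one_of_trace {ρ U : Matrix a a ℂ} {p : a → ℝ} (hU : Uᴴ * U = 1)
    (h : ρ = U * diagonal (fun i => (p i : ℂ)) * Uᴴ) (hρ : ρ.trace = 1) : ∑ i, p i = 1 := by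
  rw [h, trace_mul_cycle, hU, one_mul, trace_diagonal] at hρ
  exact_mod_cast hρ

lemma entropy_kronecker {σ : Matrix a a ℂ} {τ : Matrix b b ℂ}
    (hσ : σ ∈ densityOperators a) (hτ : τ ∈ densityOperators b) :
    entropy (σ ⊗ₖ τ) = entropy σ + entropy τ := by
  obtain ⟨U, p, hU, -, -, hUp⟩ := exists_unitary_diagonalization hσ.1
  obtain ⟨V, q, hV, -, -, hVq⟩ := exists_unitary_diagonalization hτ.1
  have hp := sum_eq_one_of_trace hU hUp hσ.2
  have hq := sum_eq_one_of_trace hV hVq hτ.2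
  have hk : σ ⊗ₖ τ = (U ⊗ₖ V) * diagonal (fun i : a × b => ((p i.1 * q i.2 : ℝ) : ℂ)) *
      (U ⊗ₖ V)ᴴ := by
    rw [hUp, hVq, mul_kronecker_mul, mul_kronecker_mul, conjTranspose_kronecker,
      diagonal_kronecker_diagonal]
    simp
  have hUV : (U ⊗ₖ V)ᴴ * (U ⊗ₖ V) = 1 := by
    rw [conjTranspose_kronecker, ← mul_kronecker_mul, hU, hV, one_kronecker_one]
  rw [hk, entropy_conj hUV, entropy_diagonal, hUp, hVq,
    entropy_conj hU (isHermitian_diagonal_ofReal p),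
    entropy_conj hV (isHermitian_diagonal_ofReal q), entropy_diagonal, entropy_diagonal]
  · simp only [negMulLog_mul, Fintype.sum_prod_type, Finset.sum_add_distrib, ← Finset.sum_mul,
      ← Finset.mul_sum, hp, hq, one_mul]
  · exact isHermitian_diagonal_ofReal _

/-- Dephasing does not decrease entropy. -/
lemma entropy_le_sum_negMulLog_diag {ρ : Matrix a a ℂ} (h : ρ.PosSemidef) :
    entropy ρ ≤ ∑ i, negMulLog (ρ i i).re := by
  obtain ⟨U, p, hU, hU', hp, hUp⟩ := exists_unitary_diagonalization h
  -- The squared moduli of U form a doubly stochastic matrix taking the spectrum to the diagonal;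
  -- Jensen then applies row by row.
  have hrow : ∀ i, ∑ j, ‖U i j‖ ^ 2 = 1 := fun i => by
    have := congr_fun (congr_fun hU' i) i
    simp only [mul_apply, conjTranspose_apply, one_apply_eq, RCLike.star_def,
      Complex.mul_conj'] at this
    exact_mod_cast this
  have hcol : ∀ j, ∑ i, ‖U i j‖ ^ 2 = 1 := fun j => by
    have := congr_fun (congr_fun hU j) j
    simp only [mul_apply, conjTranspose_apply, one_apply_eq, RCLike.star_def,
      Complex.conj_mul'] at this
    exact_mod_cast this
  have hdiag : ∀ i, (ρ i i).re = ∑ j, ‖U i j‖ ^ 2 * p j := fun i => by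
    have : ρ i i = ((∑ j, ‖U i j‖ ^ 2 * p j : ℝ) : ℂ) := by
      rw [hUp, mul_apply]
      simp only [mul_diagonal, conjTranspose_apply, RCLike.star_def]
      push_cast
      refine Finset.sum_congr rfl fun j _ => ?_
      rw [← Complex.mul_conj']
      ring
    rw [this, Complex.ofReal_re]
  have hent : entropy ρ = ∑ j, negMulLog (p j) := by
    rw [hUp, entropy_conj hU, entropy_diagonal]
    exact isHermitian_diagonal_ofReal p
  calc entropy ρ = ∑ j, (∑ i, ‖U i j‖ ^ 2) * negMulLog (p j) := by simp [hent, hcol]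
    _ = ∑ i, ∑ j, ‖U i j‖ ^ 2 * negMulLog (p j) := by
      rw [Finset.sum_comm]; simp [Finset.sum_mul]
    _ ≤ ∑ i, negMulLog (ρ i i).re := Finset.sum_le_sum fun i _ => by
      rw [hdiag]
      simpa using concaveOn_negMulLog.le_map_sum (t := Finset.univ) (w := fun j => ‖U i j‖ ^ 2)
        (p := p) (fun j _ => by positivity) (hrow i) (fun j _ => hp j)

/-- Classical subadditivity: the relative entropy of q with respect to the product of its marginals
is nonnegative, by log t ≤ t - 1 termwise. -/
lemma sum_negMulLog_le_add {a b : Type*} [Fintype a] [Fintype b]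
    {q : a × b → ℝ} {p : a → ℝ} {r : b → ℝ} (hq : ∀ i, 0 ≤ q i)
    (hp : ∀ i, p i = ∑ j, q (i, j)) (hr : ∀ j, r j = ∑ i, q (i, j)) (h1 : ∑ i, p i = 1) :
    ∑ i, negMulLog (q i) ≤ ∑ i, negMulLog (p i) + ∑ j, negMulLog (r j) := by
  have hr1 : ∑ j, r j = 1 := by
    rw [← h1]; simp only [hp, hr]; exact Finset.sum_comm
  have key : ∀ i j, negMulLog (q (i, j)) ≤
      (p i * r j - q (i, j)) + (-(q (i, j) * Real.log (p i)) - q (i, j) * Real.log (r j)) := by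
    intro i j
    have hpq : q (i, j) ≤ p i := by
      rw [hp]
      exact Finset.single_le_sum (f := fun j => q (i, j)) (fun j _ => hq _) (Finset.mem_univ j)
    have hrq : q (i, j) ≤ r j := by
      rw [hr]
      exact Finset.single_le_sum (f := fun i => q (i, j)) (fun j _ => hq _) (Finset.mem_univ i)
    rcases (hq (i, j)).eq_or_lt with h0 | h0
    · rw [← h0] at hpq hrq ⊢
      simpa using mul_nonneg hpq hrq
    · have hp0 := h0.trans_le hpq
      have hr0 := h0.trans_le hrq
      have := Real.log_le_sub_one_of_pos (div_pos (mul_pos hp0 hr0) h0)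
      rw [Real.log_div (mul_pos hp0 hr0).ne' h0.ne', Real.log_mul hp0.ne' hr0.ne'] at this
      have h2 := mul_le_mul_of_nonneg_left this h0.le
      rw [mul_sub, mul_sub (q (i, j)) (_ / _), mul_div_cancel₀ _ h0.ne'] at h2
      rw [negMulLog]
      linarith
  rw [Fintype.sum_prod_type]
  calc ∑ i, ∑ j, negMulLog (q (i, j)) ≤ ∑ i, ∑ j, ((p i * r j - q (i, j)) +
        (-(q (i, j) * Real.log (p i)) - q (i, j) * Real.log (r j))) :=
        Finset.sum_le_sum fun i _ => Finset.sum_le_sum fun j _ => key i j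
    _ = _ := by
      simp only [Finset.sum_add_distrib, Finset.sum_sub_distrib, ← Finset.mul_sum,
        Finset.sum_neg_distrib, ← Finset.sum_mul, ← hp, h1, hr1]
      rw [Finset.sum_comm (f := fun i j => q (i, j) * Real.log (r j))]
      simp only [← Finset.sum_mul, ← hr, negMulLog, neg_mul, Finset.sum_neg_distrib]
      ring

end Entropy

/-! ### Bipartite partial traces and quantum subadditivity. -/

section Subadditivity

variable {a b : Type*} [Fintype a] [Fintype b]

/-- Partial trace over the second factor. -/
def traceRight (ρ : Matrix (a × b) (a × b) ℂ) : Matrix a a ℂ :=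
  Matrix.of fun x x' => ∑ y, ρ (x, y) (x', y)

/-- Partial trace over the first factor. -/
def traceLeft (ρ : Matrix (a × b) (a × b) ℂ) : Matrix b b ℂ :=
  Matrix.of fun y y' => ∑ x, ρ (x, y) (x, y')

lemma traceLeft_eq (ρ : Matrix (a × b) (a × b) ℂ) :
    traceLeft ρ = traceRight (ρ.submatrix Prod.swap Prod.swap) := rfl

lemma trace_traceRight (ρ : Matrix (a × b) (a × b) ℂ) : (traceRight ρ).trace = ρ.trace := by
  simp [traceRight, trace, Fintype.sum_prod_type]

lemma posSemidef_traceRight {ρ : Matrix (a × b) (a × b) ℂ} (h : ρ.PosSemidef) :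
    (traceRight ρ).PosSemidef := by
  have : traceRight ρ = ∑ y, ρ.submatrix (fun x => (x, y)) (fun x => (x, y)) := by
    ext x x'
    simp [traceRight, Matrix.sum_apply]
  rw [this]
  exact posSemidef_sum _ fun y _ => h.submatrix _

lemma traceRight_mem {ρ : Matrix (a × b) (a × b) ℂ} (h : ρ ∈ densityOperators (a × b)) :
    traceRight ρ ∈ densityOperators a :=
  ⟨posSemidef_traceRight h.1, (trace_traceRight ρ).trans h.2⟩

lemma submatrix_equiv_mem {ρ : Matrix a a ℂ} (h : ρ ∈ densityOperators a) (e : b ≃ a) :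
    ρ.submatrix e e ∈ densityOperators b :=
  ⟨h.1.submatrix _, (e.sum_comp fun i => ρ i i).trans h.2⟩

lemma traceLeft_mem {ρ : Matrix (a × b) (a × b) ℂ} (h : ρ ∈ densityOperators (a × b)) :
    traceLeft ρ ∈ densityOperators b :=
  traceRight_mem (submatrix_equiv_mem h (Equiv.prodComm b a))

variable [DecidableEq a] [DecidableEq b]

lemma traceRight_conj_kronecker {U : Matrix a a ℂ} {V : Matrix b b ℂ} (hV : V * Vᴴ = 1)
    (ρ : Matrix (a × b) (a × b) ℂ) :
    traceRight ((U ⊗ₖ V)ᴴ * ρ * (U ⊗ₖ V)) = Uᴴ * traceRight ρ * U := by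
  have hVV : ∀ y y', ∑ j, V y' j * star (V y j) = if y' = y then 1 else 0 := fun y y' => by
    have := congr_fun (congr_fun hV y') y
    simpa [mul_apply, one_apply] using this
  ext i i'
  simp only [traceRight, of_apply, mul_apply, conjTranspose_apply, kroneckerMap_apply,
    Fintype.sum_prod_type, star_mul']
  calc _ = ∑ x', ∑ y', ∑ x, ∑ y, star (U x i) * ρ (x, y) (x', y') * U x' i' *
        ∑ j, V y' j * star (V y j) := by
        rw [Finset.sum_comm]
        refine Finset.sum_congr rfl fun x' _ => ?_
        rw [Finset.sum_comm]
        refine Finset.sum_congr rfl fun y' _ => ?_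
        simp only [Finset.sum_mul, Finset.mul_sum]
        rw [Finset.sum_comm]
        refine Finset.sum_congr rfl fun x _ => ?_
        rw [Finset.sum_comm]
        refine Finset.sum_congr rfl fun y _ => ?_
        refine Finset.sum_congr rfl fun j _ => ?_
        ring
    _ = _ := by
        simp only [hVV, mul_ite, mul_one, mul_zero, Finset.sum_ite_eq, Finset.mem_univ, if_true]
        refine Finset.sum_congr rfl fun x' _ => ?_
        rw [Finset.sum_comm]
        simp only [Finset.sum_mul, Finset.mul_sum]

lemma traceLeft_conj_kronecker {U : Matrix a a ℂ} {V : Matrix b b ℂ} (hU : U * Uᴴ = 1)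
    (ρ : Matrix (a × b) (a × b) ℂ) :
    traceLeft ((U ⊗ₖ V)ᴴ * ρ * (U ⊗ₖ V)) = Vᴴ * traceLeft ρ * V := by
  rw [traceLeft_eq, traceLeft_eq, ← traceRight_conj_kronecker hU]
  have : V ⊗ₖ U = (U ⊗ₖ V).submatrix Prod.swap Prod.swap := by
    ext i j
    simp [mul_comm]
  rw [this, conjTranspose_submatrix]
  congr 1
  change _ = submatrix _ (Equiv.prodComm b a) (Equiv.prodComm b a) *
    submatrix _ (Equiv.prodComm b a) (Equiv.prodComm b a) *
    submatrix _ (Equiv.prodComm b a) (Equiv.prodComm b a)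
  rw [submatrix_mul_equiv, submatrix_mul_equiv]
  rfl

lemma conjTranspose_mul_mul_diagonal {U D : Matrix a a ℂ} (hU : Uᴴ * U = 1) :
    Uᴴ * (U * D * Uᴴ) * U = D := by
  rw [← mul_assoc, ← mul_assoc, hU, one_mul, mul_assoc, hU, mul_one]

/-- Subadditivity of the von Neumann entropy. -/
theorem entropy_le_add {ρ : Matrix (a × b) (a × b) ℂ} (h : ρ ∈ densityOperators (a × b)) :
    entropy ρ ≤ entropy (traceRight ρ) + entropy (traceLeft ρ) := by
  obtain ⟨U, p, hU, hU', -, hUp⟩ := exists_unitary_diagonalization (traceRight_mem h).1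
  -- In the product of the marginals' eigenbases, the diagonal of ρ is a joint distribution whose
  -- marginals are the two spectra, so dephasing reduces to the classical case.
  obtain ⟨V, r, hV, hV', -, hVr⟩ := exists_unitary_diagonalization (traceLeft_mem h).1
  set T := U ⊗ₖ V
  have hT : T * Tᴴ = 1 := by
    rw [conjTranspose_kronecker, ← mul_kronecker_mul, hU', hV', one_kronecker_one]
  have hpsd : (Tᴴ * ρ * T).PosSemidef := h.1.conjTranspose_mul_mul_same T
  have h1 : entropy (Tᴴ * ρ * T) = entropy ρ := by
    simpa using entropy_conj (U := Tᴴ) (by simpa using hT) h.1.1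
  have hR : traceRight (Tᴴ * ρ * T) = diagonal fun i => (p i : ℂ) := by
    rw [traceRight_conj_kronecker hV', hUp, conjTranspose_mul_mul_diagonal hU]
  have hL : traceLeft (Tᴴ * ρ * T) = diagonal fun i => (r i : ℂ) := by
    rw [traceLeft_conj_kronecker hU', hVr, conjTranspose_mul_mul_diagonal hV]
  have hq : ∀ i, 0 ≤ ((Tᴴ * ρ * T) i i).re := fun i =>
    (Complex.nonneg_iff.mp hpsd.diag_nonneg).1
  rw [hUp, hVr, entropy_conj hU (isHermitian_diagonal_ofReal p),
    entropy_conj hV (isHermitian_diagonal_ofReal r), entropy_diagonal, entropy_diagonal, ← h1]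
  refine (entropy_le_sum_negMulLog_diag hpsd).trans
    (sum_negMulLog_le_add hq (fun i => ?_) (fun j => ?_)
      (sum_eq_one_of_trace hU hUp (traceRight_mem h).2))
  · have := congr_arg Complex.re (congr_fun (congr_fun hR i) i)
    simpa [traceRight] using this.symm
  · have := congr_arg Complex.re (congr_fun (congr_fun hL j) j)
    simpa [traceLeft] using this.symm

end Subadditivity

/-! ### Kraus operators and the Knill–Laflamme condition. -/

section Kraus

variable {a b e : Type*} [Fintype a] [DecidableEq a] [Fintype b] [Fintype e]

/-- The completely positive map with Kraus operators `K`. -/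
def krausMap (K : e → Matrix b a ℂ) : Matrix a a ℂ →ₗ[ℂ] Matrix b b ℂ where
  toFun A := ∑ z, K z * A * (K z)ᴴ
  map_add' A B := by simp [Matrix.mul_add, Matrix.add_mul, Finset.sum_add_distrib]
  map_smul' c A := by simp [Finset.smul_sum]

lemma krausMap_apply (K : e → Matrix b a ℂ) (A : Matrix a a ℂ) :
    krausMap K A = ∑ z, K z * A * (K z)ᴴ := rfl

lemma krausMap_single (K : e → Matrix b a ℂ) (i j : a) (s t : b) :
    krausMap K (single i j 1) s t = ∑ z, K z s i * star (K z t j) := by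
  simp [krausMap_apply, Matrix.sum_apply, mul_apply, single_apply, Finset.sum_ite_eq, ite_and]

lemma linearMap_ext_single {M : Type*} [AddCommMonoid M] [Module ℂ M]
    {F G : Matrix a a ℂ →ₗ[ℂ] M} (h : ∀ i j, F (single i j 1) = G (single i j 1)) : F = G := by
  refine LinearMap.ext fun A => ?_
  rw [matrix_eq_sum_single A]
  simp only [map_sum]
  refine Finset.sum_congr rfl fun i _ => Finset.sum_congr rfl fun j _ => ?_
  have : single i j (A i j) = A i j • single i j (1 : ℂ) := by simp [smul_single]
  rw [this, map_smul, map_smul, h]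

lemma linearMap_eq_zero_of_densityOperators {M : Type*} [AddCommGroup M] [Module ℂ M]
    {F : Matrix a a ℂ →ₗ[ℂ] M} (h : ∀ ρ ∈ densityOperators a, F ρ = 0) : F = 0 := by
  have h1 : ∀ x : a → ℂ, F (vecMulVec x (star x)) = 0 := fun x => by
    by_cases hx : star x ⬝ᵥ x = 0
    · rw [dotProduct_star_self_eq_zero.mp hx]
      simp
    · have hpos : 0 ≤ star x ⬝ᵥ x := dotProduct_star_self_nonneg x
      have hmem : (star x ⬝ᵥ x)⁻¹ • vecMulVec x (star x) ∈ densityOperators a := by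
        refine ⟨(posSemidef_vecMulVec_self_star x).smul (inv_nonneg.mpr hpos), ?_⟩
        rw [trace_smul, trace_vecMulVec, dotProduct_comm x, smul_eq_mul, inv_mul_cancel₀ hx]
      have := h _ hmem
      rw [map_smul] at this
      exact (smul_eq_zero.mp this).resolve_left (inv_ne_zero hx)
  -- Polarization, using x + y and x + iy.
  have h2 : ∀ x y : a → ℂ, F (vecMulVec x (star y)) = 0 := fun x y => by
    have e1 := h1 (x + y)
    have e2 := h1 (x + Complex.I • y)
    simp only [star_add, star_smul, add_vecMulVec, vecMulVec_add, smul_vecMulVec, vecMulVec_smul,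
      map_add, map_smul, h1, zero_add, add_zero, smul_zero] at e1 e2
    have e3 : F (vecMulVec y (star x)) = -F (vecMulVec x (star y)) := by
      rw [eq_neg_iff_add_eq_zero]; exact e1
    rw [e3] at e2
    have e4 : (2 * Complex.I) • F (vecMulVec x (star y)) = 0 := by
      have : (star Complex.I) = -Complex.I := Complex.conj_I
      rw [this] at e2
      rw [← neg_eq_zero, ← e2]
      module
    exact (smul_eq_zero.mp e4).resolve_left (by simp)
  refine linearMap_ext_single fun i j => ?_
  have := h2 (Pi.single i 1) (Pi.single j 1)
  rw [LinearMap.zero_apply, ← this]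
  congr 1
  ext s t
  simp only [single_apply, vecMulVec_apply, Pi.single_apply, Pi.star_apply, eq_comm (b := s),
    eq_comm (b := t)]
  by_cases hs : s = i <;> by_cases ht : t = j <;> simp [hs, ht]

/-- A linear map agreeing with another on states agrees everywhere. -/
lemma linearMap_ext_densityOperators {M : Type*} [AddCommGroup M] [Module ℂ M]
    {F G : Matrix a a ℂ →ₗ[ℂ] M} (h : ∀ ρ ∈ densityOperators a, F ρ = G ρ) : F = G :=
  sub_eq_zero.mp (linearMap_eq_zero_of_densityOperators fun ρ hρ => by simp [h ρ hρ])

lemma eq_of_trace_mul_eq {X Y : Matrix a a ℂ}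
    (h : ∀ ρ ∈ densityOperators a, (X * ρ).trace = (Y * ρ).trace) : X = Y := by
  have := linearMap_ext_densityOperators
    (F := traceLinearMap a ℂ ℂ ∘ₗ LinearMap.mulLeft ℂ X)
    (G := traceLinearMap a ℂ ℂ ∘ₗ LinearMap.mulLeft ℂ Y) (by simpa using h)
  ext i j
  have hij := LinearMap.congr_fun this (single j i 1)
  simpa [trace_mul_single] using hij

/-- Kraus decomposition of a quantum operation. -/
lemma IsQuantumOperation.exists_kraus [DecidableEq b] {E : Matrix a a ℂ →ₗ[ℂ] Matrix b b ℂ}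
    (hE : IsQuantumOperation E) :
    ∃ K : Fin (Fintype.card a) × b → Matrix b a ℂ, E = krausMap K := by
  let f := Fintype.equivFin a
  -- The unnormalized maximally entangled vector: its image is the Choi matrix, and the columns of a
  -- factor S, reshaped, are the Kraus operators.
  let v : Fin (Fintype.card a) × a → ℂ := fun p => if f p.2 = p.1 then 1 else 0
  obtain ⟨S, hS⟩ := exists_eq_mul_conjTranspose
    (hE.completelyPositive _ _ (posSemidef_vecMulVec_self_star v))
  refine ⟨fun z => Matrix.of fun s i => S (f i, s) z, linearMap_ext_single fun i j => ?_⟩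
  ext s t
  have h := congr_fun (congr_fun hS (f i, s)) (f j, t)
  have hsingle : (Matrix.of fun i' j' => vecMulVec v (star v) (f i, i') (f j, j')) =
      single i j (1 : ℂ) := by
    ext i' j'
    simp only [v, single_apply, vecMulVec_apply, Pi.star_apply, of_apply, f.injective.eq_iff,
      eq_comm (b := i'), eq_comm (b := j')]
    by_cases hs : i' = i <;> by_cases ht : j' = j <;> simp [hs, ht]
  rw [krausMap_single]
  simp only [ampliation, of_apply, hsingle] at h
  rw [h]
  simp [mul_apply]

lemma sum_conjTranspose_mul_self {K : e → Matrix b a ℂ}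
    (h : ∀ A, (krausMap K A).trace = A.trace) : ∑ z, (K z)ᴴ * K z = 1 := by
  refine eq_of_trace_mul_eq fun ρ _ => ?_
  rw [one_mul, ← h ρ, krausMap_apply, trace_sum, Matrix.sum_mul, trace_sum]
  exact Finset.sum_congr rfl fun z _ => by rw [trace_mul_cycle (K z) ρ]

lemma sum_norm_sq_eq_zero {u : e → ℂ} (h : ∑ z, u z * star (u z) = 0) (z : e) : u z = 0 := by
  have h' : ∑ z, ‖u z‖ ^ 2 = 0 := by
    simp only [RCLike.star_def, Complex.mul_conj'] at h
    exact_mod_cast h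
  rw [Finset.sum_eq_zero_iff_of_nonneg fun _ _ => by positivity] at h'
  simpa using h' z (Finset.mem_univ z)

/-- The Kraus operators of the identity are scalars. -/
lemma exists_eq_smul_one_of_krausMap_eq_id {K : e → Matrix a a ℂ}
    (h : krausMap K = LinearMap.id) : ∃ c : e → ℂ, ∀ z, K z = c z • 1 := by
  rcases isEmpty_or_nonempty a with ha | ⟨⟨i₀⟩⟩
  · exact ⟨0, fun z => Subsingleton.elim _ _⟩
  have hs : ∀ i j s t, ∑ z, K z s i * star (K z t j) = single i j (1 : ℂ) s t :=
    fun i j s t => by rw [← krausMap_single, h, LinearMap.id_apply]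
  refine ⟨fun z => K z i₀ i₀, fun z => ?_⟩
  ext s i
  by_cases hsi : s = i
  · subst hsi
    -- Each of the four sums in the expansion is 1, with signs 1 - 1 - 1 + 1.
    have : ∑ z, (K z s s - K z i₀ i₀) * star (K z s s - K z i₀ i₀) = 0 := by
      simp only [star_sub, sub_mul, mul_sub, Finset.sum_sub_distrib, hs]
      simp
    simpa [sub_eq_zero] using sum_norm_sq_eq_zero this z
  · have : ∑ z, K z s i * star (K z s i) = 0 := by
      rw [hs]; simp [Ne.symm hsi]
    simpa [hsi] using sum_norm_sq_eq_zero this z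

/-- The Knill–Laflamme condition for reversibility on all states. -/
lemma Reversible.exists_conjTranspose_mul_eq_smul [DecidableEq b] {K : e → Matrix b a ℂ}
    (h : Reversible (krausMap K) (densityOperators a)) :
    ∃ c : Matrix e e ℂ, ∀ z w, (K z)ᴴ * K w = c z w • 1 := by
  obtain ⟨R, hR, hRK⟩ := h
  obtain ⟨T, rfl⟩ := hR.exists_kraus
  -- The products T t * K z are Kraus operators of the identity, hence scalars.
  have hid : krausMap (fun p : (Fin (Fintype.card b) × a) × e => T p.1 * K p.2) =
      LinearMap.id := linearMap_ext_densityOperators fun ρ hρ => by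
    conv_rhs => rw [LinearMap.id_apply, ← hRK ρ hρ]
    simp only [krausMap_apply, Matrix.mul_sum, Matrix.sum_mul, conjTranspose_mul,
      Matrix.mul_assoc]
    rw [Fintype.sum_prod_type]
  obtain ⟨l, hl⟩ := exists_eq_smul_one_of_krausMap_eq_id hid
  refine ⟨Matrix.of fun z w => ∑ t, star (l (t, z)) * l (t, w), fun z w => ?_⟩
  have hT := sum_conjTranspose_mul_self hR.tracePreserving
  calc (K z)ᴴ * K w = (K z)ᴴ * (∑ t, (T t)ᴴ * T t) * K w := by rw [hT, Matrix.mul_one]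
    _ = ∑ t, (T t * K z)ᴴ * (T t * K w) := by
      simp [Matrix.mul_sum, Matrix.sum_mul, Matrix.mul_assoc]
    _ = _ := by
      have := fun t z => hl (t, z)
      dsimp only at this
      simp [this, Finset.sum_smul, smul_smul, mul_comm]

lemma trace_mul_mul_conjTranspose {A B : Matrix b a ℂ} {c : ℂ} (h : Bᴴ * A = c • 1)
    {σ : Matrix a a ℂ} (hσ : σ.trace = 1) : (A * σ * Bᴴ).trace = c := by
  rw [trace_mul_cycle, h]
  simp [hσ]

/-- A reversible operation adds the entropy of its environment to that of the input. -/
lemma entropy_krausMap [DecidableEq b] [DecidableEq e] {K : e → Matrix b a ℂ} {c : Matrix e e ℂ}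
    (h : ∀ z w, (K z)ᴴ * K w = c z w • 1) {σ : Matrix a a ℂ} (hσ : σ ∈ densityOperators a)
    (hc : c.trace = 1) : entropy (krausMap K σ) = entropy σ + entropy c := by
  obtain ⟨S, hS⟩ := exists_eq_mul_conjTranspose hσ.1
  have ha : Nonempty a := by
    by_contra ha
    rw [not_nonempty_iff] at ha
    simp [densityOperators, trace] at hσ
  obtain ⟨x⟩ := ha
  have hcd : c ∈ densityOperators e := by
    refine ⟨?_, hc⟩
    have : c = (Matrix.of fun s z => K z s x)ᴴ * Matrix.of fun s z => K z s x := by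
      ext z w
      have := congr_fun (congr_fun (h z w) x) x
      simpa [mul_apply, eq_comm] using this
    rw [this]
    exact posSemidef_conjTranspose_mul_self _
  have hSd : Sᴴ * S ∈ densityOperators a :=
    ⟨posSemidef_conjTranspose_mul_self S, by rw [trace_mul_comm, ← hS, hσ.2]⟩
  -- The blocks K z * S side by side: one Gram matrix of M is the output, the other is input (up to
  -- spectrum) tensor environment.
  let M : Matrix b (a × e) ℂ := Matrix.of fun s p => (K p.2 * S) s p.1
  have h1 : krausMap K σ = M * Mᴴ := by
    ext s t
    have : ∀ z, K z * σ * (K z)ᴴ = (K z * S) * (K z * S)ᴴ := fun z => by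
      rw [hS, conjTranspose_mul]; simp only [Matrix.mul_assoc]
    simp only [krausMap_apply, this, Matrix.sum_apply]
    rw [mul_apply, Fintype.sum_prod_type_right]
    refine Finset.sum_congr rfl fun z _ => ?_
    rw [mul_apply]
    rfl
  have h2 : Mᴴ * M = (Sᴴ * S) ⊗ₖ c := by
    ext ⟨x, z⟩ ⟨x', w⟩
    have : (K z * S)ᴴ * (K w * S) = c z w • (Sᴴ * S) := by
      rw [conjTranspose_mul, Matrix.mul_assoc, ← Matrix.mul_assoc (K z)ᴴ, h]
      simp
    have := congr_fun (congr_fun this x) x'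
    rw [kroneckerMap_apply, mul_comm]
    rw [Matrix.smul_apply, smul_eq_mul] at this
    rw [← this, mul_apply, mul_apply]
    rfl
  rw [h1, entropy_mul_conjTranspose, h2, entropy_kronecker hSd hcd, ← entropy_mul_conjTranspose,
    ← hS]

end Kraus

/-! ### Exchanging a subsystem with the environment. -/

section Core

variable {a x y e : Type*} [Fintype a] [DecidableEq a] [Fintype x] [DecidableEq x]
  [Fintype y] [DecidableEq y] [Fintype e] [DecidableEq e]

/-- Kraus operators indexed by `x`, obtained by exchanging the roles of the
subsystem `x` and the environment `e`. -/
def exchange (A : e → Matrix (x × y) a ℂ) (u : x) : Matrix (y × e) a ℂ :=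
  Matrix.of fun p s => A p.2 (u, p.1) s

lemma traceLeft_krausMap_exchange {A : e → Matrix (x × y) a ℂ} (σ : Matrix a a ℂ) (i j : e) :
    traceLeft (krausMap (exchange A) σ) i j = (A i * σ * (A j)ᴴ).trace := by
  simp only [traceLeft, krausMap_apply, of_apply, Matrix.sum_apply, trace, diag_apply,
    Fintype.sum_prod_type]
  rw [Finset.sum_comm]
  rfl

lemma traceRight_krausMap {A : e → Matrix (x × y) a ℂ} (σ : Matrix a a ℂ) (u w : x) :
    traceRight (krausMap A σ) u w = (exchange A u * σ * (exchange A w)ᴴ).trace := by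
  simp only [traceRight, krausMap_apply, of_apply, Matrix.sum_apply, trace, diag_apply,
    Fintype.sum_prod_type]
  rfl

lemma traceRight_krausMap_exchange {A : e → Matrix (x × y) a ℂ} (σ : Matrix a a ℂ) :
    traceRight (krausMap (exchange A) σ) = traceLeft (krausMap A σ) := by
  ext v v'
  simp only [traceLeft, traceRight, krausMap_apply, of_apply, Matrix.sum_apply]
  rw [Finset.sum_comm]
  rfl

lemma posSemidef_krausMap {b : Type*} [Fintype b] (K : e → Matrix b a ℂ) {σ : Matrix a a ℂ}
    (hσ : σ.PosSemidef) : (krausMap K σ).PosSemidef :=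
  posSemidef_sum _ fun z _ => hσ.mul_mul_conjTranspose_same (K z)

/-- If `x × y` recovers the input while `x` carries no information about it, then the
entropy of `y` is at least that of the input. -/
theorem entropy_le_of_reversible_of_vanishing {A : e → Matrix (x × y) a ℂ}
    (hrev : Reversible (krausMap A) (densityOperators a))
    {ρ₀ : Matrix x x ℂ} (hvan : ∀ ρ ∈ densityOperators a, traceRight (krausMap A ρ) = ρ₀)
    {σ : Matrix a a ℂ} (hσ : σ ∈ densityOperators a) (htr : (krausMap A σ).trace = 1) :
    entropy σ ≤ entropy (traceLeft (krausMap A σ)) := by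
  obtain ⟨c, hc⟩ := hrev.exists_conjTranspose_mul_eq_smul
  -- Vanishing on x says that pairing this operator with any state gives the same number, which
  -- forces it to be scalar.
  have hc' : ∀ u w, (exchange A u)ᴴ * exchange A w = ρ₀ᵀ u w • 1 := fun u w =>
    eq_of_trace_mul_eq fun ρ hρ => by
      rw [← trace_mul_cycle, ← traceRight_krausMap, hvan ρ hρ]
      simp [hρ.2]
  have hρd : krausMap A σ ∈ densityOperators (x × y) := ⟨posSemidef_krausMap A hσ.1, htr⟩
  have hEc : traceLeft (krausMap (exchange A) σ) = cᵀ := by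
    ext i j
    rw [traceLeft_krausMap_exchange, trace_mul_mul_conjTranspose (hc j i) hσ.2, transpose_apply]
  have hτd : krausMap (exchange A) σ ∈ densityOperators (y × e) :=
    ⟨posSemidef_krausMap _ hσ.1, by
      rw [← trace_traceRight, traceRight_krausMap_exchange]
      exact (traceLeft_mem hρd).2⟩
  have hct : c.trace = 1 := by
    rw [← trace_transpose, ← hEc]; exact (traceLeft_mem hτd).2
  have hch : c.IsHermitian := by
    rw [← isHermitian_transpose_iff, ← hEc]; exact (traceLeft_mem hτd).1.1
  have hρ₀ : ρ₀ ∈ densityOperators x := hvan σ hσ ▸ traceRight_mem hρd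
  have e1 := entropy_krausMap hc hσ hct
  have e2 := entropy_krausMap hc' hσ (by rw [trace_transpose]; exact hρ₀.2)
  have s1 := entropy_le_add hρd
  have s2 := entropy_le_add hτd
  rw [hvan σ hσ] at s1
  rw [traceRight_krausMap_exchange, hEc, entropy_transpose hch] at s2
  rw [entropy_transpose hρ₀.1.1] at e2
  linarith

end Core

/-! ### The average of an ensemble of pure states. -/

section AverageState

open MeasureTheory

variable {a : Type*} [Fintype a]

lemma norm_le_one_of_mem_pureStates {ρ : Matrix a a ℂ} (h : ρ ∈ pureStates a) (i j : a) :
    ‖ρ i j‖ ≤ 1 := by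
  obtain ⟨ψ, hψ, rfl⟩ := h
  have h1 : ∑ i, ‖ψ i‖ ^ 2 = 1 := by
    simp only [dotProduct, Pi.star_apply, RCLike.star_def, Complex.conj_mul'] at hψ
    exact_mod_cast hψ
  have h2 : ∀ i, ‖ψ i‖ ≤ 1 := fun i => by
    have := Finset.single_le_sum (f := fun i => ‖ψ i‖ ^ 2) (fun _ _ => by positivity)
      (Finset.mem_univ i)
    rw [h1] at this
    exact (sq_le_one_iff₀ (norm_nonneg _)).mp this
  rw [vecMulVec_apply, norm_mul, Pi.star_apply, norm_star]
  exact mul_le_one₀ (h2 i) (norm_nonneg _) (h2 j)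

lemma mem_densityOperators_of_mem_pureStates {ρ : Matrix a a ℂ} (h : ρ ∈ pureStates a) :
    ρ ∈ densityOperators a := by
  obtain ⟨ψ, hψ, rfl⟩ := h
  exact ⟨posSemidef_vecMulVec_self_star ψ, by rw [trace_vecMulVec, dotProduct_comm, hψ]⟩

lemma integrable_entry (μ : Measure (pureStates a)) [IsProbabilityMeasure μ] (i j : a) :
    Integrable (fun ρ : pureStates a => (ρ : Matrix a a ℂ) i j) μ := by
  refine Integrable.of_bound (C := 1) ?_
    (.of_forall fun ρ => norm_le_one_of_mem_pureStates ρ.2 i j)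
  exact (continuous_subtype_val.matrix_elem i j).aestronglyMeasurable

lemma averageState_mem (μ : Measure (pureStates a)) [IsProbabilityMeasure μ] :
    averageState μ ∈ densityOperators a := by
  have hint := integrable_entry μ
  refine ⟨.of_dotProduct_mulVec_nonneg ?_ fun v => ?_, ?_⟩
  · ext i j
    simp only [averageState, conjTranspose_apply, of_apply, RCLike.star_def]
    rw [← integral_conj]
    refine integral_congr_ae (.of_forall fun ρ => ?_)
    exact (mem_densityOperators_of_mem_pureStates ρ.2).1.1.apply i j
  · have : star v ⬝ᵥ (averageState μ *ᵥ v) =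
        ∫ ρ : pureStates a, star v ⬝ᵥ ((ρ : Matrix a a ℂ) *ᵥ v) ∂μ := by
      simp only [dotProduct, mulVec, averageState, of_apply]
      rw [integral_finsetSum _ fun i _ =>
        (integrable_finsetSum _ fun j _ => (hint i j).mul_const _).const_mul _]
      refine Finset.sum_congr rfl fun i _ => ?_
      rw [integral_const_mul, integral_finsetSum _ fun j _ => (hint i j).mul_const _]
      simp only [integral_mul_const]
    rw [this]
    exact integral_nonneg fun ρ =>
      (mem_densityOperators_of_mem_pureStates ρ.2).1.dotProduct_mulVec_nonneg v
  · simp only [trace, diag_apply, averageState, of_apply]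
    rw [← integral_finsetSum _ fun i _ => hint i i]
    have : ∀ ρ : pureStates a, ∑ i, (ρ : Matrix a a ℂ) i i = 1 := fun ρ =>
      (mem_densityOperators_of_mem_pureStates ρ.2).2
    simp [this]

end AverageState

/-! ### Partial traces over sets of shares. -/

section PartialTrace

variable {n : ℕ} {d : Fin n → Type*} [∀ i, Fintype (d i)]

lemma trace_partialTrace (X : Finset (Fin n)) (A : Matrix (∀ i, d i) (∀ i, d i) ℂ) :
    (partialTrace d X A).trace = A.trace := by
  rw [trace, trace, ← (Equiv.piEquivPiSubtypeProd (· ∈ X) d).symm.sum_comp, Fintype.sum_prod_type]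
  rfl

lemma partialTrace_mem (X : Finset (Fin n)) {A : Matrix (∀ i, d i) (∀ i, d i) ℂ}
    (hA : A ∈ densityOperators (∀ i, d i)) :
    partialTrace d X A ∈ densityOperators (ShareIndex d X) := by
  refine ⟨?_, (trace_partialTrace X A).trans hA.2⟩
  have : partialTrace d X A = ∑ z, A.submatrix
      (fun x => (Equiv.piEquivPiSubtypeProd (· ∈ X) d).symm (x, z))
      (fun x => (Equiv.piEquivPiSubtypeProd (· ∈ X) d).symm (x, z)) := by
    ext x y
    simp [partialTrace, Matrix.sum_apply]
  rw [this]
  exact posSemidef_sum _ fun z _ => hA.1.submatrix _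

variable [∀ i, DecidableEq (d i)]

/-- Sums over full configurations put the traces for X, Y and X ∪ Y on one index set, so they can be
compared without transporting dependent functions. -/
lemma partialTrace_apply_eq_sum_ite (X : Finset (Fin n)) (A : Matrix (∀ i, d i) (∀ i, d i) ℂ)
    (x x' : ShareIndex d X) :
    partialTrace d X A x x' = ∑ f, ∑ g, if (fun i : {i // i ∈ X} => f i) = x ∧
      (fun i : {i // i ∈ X} => g i) = x' ∧ (∀ i ∉ X, f i = g i) then A f g else 0 := by
  let e := Equiv.piEquivPiSubtypeProd (· ∈ X) d
  rw [← e.symm.sum_comp]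
  simp only [← e.symm.sum_comp (fun g => ite _ (A _ g) 0)]
  have h1 : ∀ p, (fun i : {i // i ∈ X} => e.symm p i) = p.1 := fun p =>
    congr_arg Prod.fst (e.apply_symm_apply p)
  have h2 : ∀ p q, (∀ i ∉ X, e.symm p i = e.symm q i) ↔ q.2 = p.2 := fun p q => by
    have h : ∀ p, (fun i : {i // i ∉ X} => e.symm p i) = p.2 := fun p =>
      congr_arg Prod.snd (e.apply_symm_apply p)
    rw [← h p, ← h q, funext_iff, Subtype.forall]
    exact forall₂_congr fun i hi => eq_comm
  simp only [h1, h2, Fintype.sum_prod_type, ite_and]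
  simp [partialTrace, e]

variable {X Y : Finset (Fin n)} (h : Disjoint X Y)

lemma restrict_eq_piFinsetUnion_iff (f : ∀ i, d i) (p : ShareIndex d X × ShareIndex d Y) :
    (fun i : {i // i ∈ X ∪ Y} => f i) = Equiv.piFinsetUnion d h p ↔
      (fun i : {i // i ∈ X} => f i) = p.1 ∧ (fun i : {i // i ∈ Y} => f i) = p.2 := by
  have : (fun i : {i // i ∈ X ∪ Y} => f i) = Equiv.piFinsetUnion d h
      (fun i : {i // i ∈ X} => f i, fun i : {i // i ∈ Y} => f i) := by
    funext ⟨i, hi⟩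
    rcases Finset.mem_union.mp hi with hX | hY
    · exact (Equiv.piFinsetUnion_left d h (f := fun i : {i // i ∈ X} => f i)
        (g := fun i : {i // i ∈ Y} => f i) hX hi).symm
    · exact (Equiv.piFinsetUnion_right d h (f := fun i : {i // i ∈ X} => f i)
        (g := fun i : {i // i ∈ Y} => f i) hY hi).symm
  rw [this, (Equiv.injective _).eq_iff, Prod.ext_iff]

lemma traceRight_partialTrace_union (A : Matrix (∀ i, d i) (∀ i, d i) ℂ) :
    traceRight ((partialTrace d (X ∪ Y) A).submatrix (Equiv.piFinsetUnion d h)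
      (Equiv.piFinsetUnion d h)) = partialTrace d X A := by
  ext x x'
  simp only [traceRight, of_apply, submatrix_apply, partialTrace_apply_eq_sum_ite,
    restrict_eq_piFinsetUnion_iff]
  rw [Finset.sum_comm]
  refine Finset.sum_congr rfl fun f _ => ?_
  rw [Finset.sum_comm]
  refine Finset.sum_congr rfl fun g _ => ?_
  -- Agreement on Y and agreement off X ∪ Y combine into agreement off X; only y = f restricted to Y
  -- survives.
  have : ∀ y : ShareIndex d Y, (((fun i : {i // i ∈ X} => f i) = x ∧
      (fun i : {i // i ∈ Y} => f i) = y) ∧ ((fun i : {i // i ∈ X} => g i) = x' ∧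
      (fun i : {i // i ∈ Y} => g i) = y) ∧ ∀ i ∉ X ∪ Y, f i = g i) ↔
      (fun i : {i // i ∈ Y} => f i) = y ∧ ((fun i : {i // i ∈ X} => f i) = x ∧
      (fun i : {i // i ∈ X} => g i) = x' ∧ ∀ i ∉ X, f i = g i) := fun y => by
    constructor
    · rintro ⟨⟨h1, h2⟩, ⟨h3, h4⟩, h5⟩
      refine ⟨h2, h1, h3, fun i hi => ?_⟩
      by_cases hY : i ∈ Y
      · exact congr_fun (h2.trans h4.symm) ⟨i, hY⟩
      · exact h5 i (by simp [hi, hY])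
    · rintro ⟨h1, h2, h3, h4⟩
      refine ⟨⟨h2, h1⟩, ⟨h3, ?_⟩, fun i hi => h4 i fun hX => hi (Finset.mem_union_left _ hX)⟩
      rw [← h1]
      exact funext fun i => (h4 i (Finset.disjoint_right.mp h i.2)).symm
  simp only [this]
  simp only [ite_and (_ = _) (_ ∧ _), Finset.sum_ite_eq, Finset.mem_univ, if_true]

lemma traceLeft_partialTrace_union (A : Matrix (∀ i, d i) (∀ i, d i) ℂ) :
    traceLeft ((partialTrace d (X ∪ Y) A).submatrix (Equiv.piFinsetUnion d h)
      (Equiv.piFinsetUnion d h)) = partialTrace d Y A := by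
  rw [← traceRight_partialTrace_union h.symm, traceLeft_eq]
  congr 1
  ext p q
  simp only [submatrix_apply, partialTrace_apply_eq_sum_ite, restrict_eq_piFinsetUnion_iff,
    Finset.union_comm Y X, Prod.fst_swap, Prod.snd_swap, and_comm]

lemma entropy_le_zero_of_unique {c : Type*} [Fintype c] [DecidableEq c] [Unique c]
    {ρ : Matrix c c ℂ} (h : ρ ∈ densityOperators c) : entropy ρ ≤ 0 := by
  refine (entropy_le_sum_negMulLog_diag h.1).trans ?_
  have := h.2
  simp [trace] at this
  simp [this]

/-- The entropy of a group of shares is at most the sum of the entropies of the shares. -/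
lemma entropy_partialTrace_le_sum {A : Matrix (∀ i, d i) (∀ i, d i) ℂ}
    (hA : A ∈ densityOperators (∀ i, d i)) (Y : Finset (Fin n)) :
    entropy (partialTrace d Y A) ≤ ∑ i ∈ Y, entropy (partialTrace d {i} A) := by
  induction Y using Finset.induction_on with
  | empty =>
    rw [Finset.sum_empty]
    exact entropy_le_zero_of_unique (partialTrace_mem ∅ hA)
  | insert i Y hi ih =>
    have h : Disjoint {i} Y := Finset.disjoint_singleton_left.mpr hi
    have hm := partialTrace_mem ({i} ∪ Y) hA
    have := entropy_le_add (submatrix_equiv_mem hm (Equiv.piFinsetUnion d h))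
    rw [traceRight_partialTrace_union, traceLeft_partialTrace_union] at this
    have hr := entropy_reindex (Equiv.piFinsetUnion d h).symm hm.1.1
    rw [reindex_apply, Equiv.symm_symm] at hr
    rw [hr] at this
    rw [Finset.sum_insert hi, Finset.insert_eq]
    linarith

end PartialTrace

/-! ### Entropy bounds for schemes. -/

section Schemes

variable {a : Type*} [Fintype a]

lemma Reversible.submatrix {b c : Type*} [Fintype b] [Fintype c]
    {E : Matrix a a ℂ →ₗ[ℂ] Matrix b b ℂ} {E' : Matrix a a ℂ →ₗ[ℂ] Matrix c c ℂ}
    {S : Set (Matrix a a ℂ)} (e : c ≃ b) (h : ∀ ρ, E' ρ = (E ρ).submatrix e e)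
    (hE : Reversible E S) : Reversible E' S := by
  obtain ⟨R, hR, hRE⟩ := hE
  refine ⟨R ∘ₗ (reindexLinearEquiv ℂ ℂ e e).toLinearMap, ⟨fun m M hM => ?_, fun A => ?_⟩,
    fun ρ hρ => ?_⟩
  · exact hR.completelyPositive m _ (hM.submatrix (Prod.map id e.symm))
  · exact (hR.tracePreserving _).trans (e.symm.sum_comp fun i => A i i)
  · conv_rhs => rw [← hRE ρ hρ]
    rw [h]
    simp

lemma IsQuantumOperation.map_mem [DecidableEq a] {b : Type*} [Fintype b] [DecidableEq b]
    {E : Matrix a a ℂ →ₗ[ℂ] Matrix b b ℂ} (hE : IsQuantumOperation E) {σ : Matrix a a ℂ}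
    (hσ : σ ∈ densityOperators a) : E σ ∈ densityOperators b := by
  refine ⟨?_, (hE.tracePreserving σ).trans hσ.2⟩
  obtain ⟨K, rfl⟩ := hE.exists_kraus
  exact posSemidef_krausMap K hσ.1

variable {n : ℕ} {d : Fin n → Type*} [∀ i, Fintype (d i)] [∀ i, DecidableEq (d i)]
  {W : Matrix a a ℂ →ₗ[ℂ] Matrix (∀ i, d i) (∀ i, d i) ℂ}

lemma IsScheme.qualified_univ (hW : IsScheme W) : Qualified W Finset.univ := by
  have : IsEmpty {i : Fin n // i ∉ Finset.univ} := ⟨fun i => i.2 (Finset.mem_univ _)⟩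
  refine hW.reversible.submatrix ((Equiv.prodUnique (ShareIndex d Finset.univ)
    (∀ i : {i : Fin n // i ∉ Finset.univ}, d i)).symm.trans
    (Equiv.piEquivPiSubtypeProd (· ∈ Finset.univ) d).symm) fun ρ => ?_
  ext x y
  simp only [marginal, LinearMap.comp_apply, partialTrace, LinearMap.coe_mk, AddHom.coe_mk,
    of_apply]
  rw [Fintype.sum_unique]
  rfl

/-- With no shares the space is one-dimensional and the trace determines the state. In a ramp scheme
this forces L ≤ k. -/
lemma IsScheme.forbidden_empty (hW : IsScheme W) : Forbidden W ∅ := by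
  refine ⟨1, ⟨.one, by simp⟩, fun ρ hρ => ?_⟩
  have h : (marginal W ∅ ρ).trace = 1 :=
    (trace_partialTrace ∅ _).trans ((hW.isQuantumOperation.tracePreserving ρ).trans hρ.2)
  ext x y
  rw [Subsingleton.elim y x]
  rw [trace, Fintype.sum_unique, diag_apply] at h
  rw [Subsingleton.elim x default, h, one_apply_eq]

variable [DecidableEq a]

/-- A set of shares that completes a forbidden set to a qualified one carries at least the
entropy of the secret. -/
lemma entropy_le_entropy_marginal (hW : IsScheme W) {X Y : Finset (Fin n)} (h : Disjoint X Y)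
    (hX : Forbidden W X) (hXY : Qualified W (X ∪ Y)) {σ : Matrix a a ℂ}
    (hσ : σ ∈ densityOperators a) : entropy σ ≤ entropy (marginal W Y σ) := by
  obtain ⟨K, hK⟩ := hW.isQuantumOperation.exists_kraus
  let u := Equiv.piFinsetUnion d h
  -- The environment of the marginal consists of that of W and the traced-out shares.
  let A : (Fin (Fintype.card a) × ∀ i, d i) × (∀ i : {i // i ∉ X ∪ Y}, d i) →
      Matrix (ShareIndex d X × ShareIndex d Y) a ℂ := fun z => (K z.1).submatrix
        (fun p => (Equiv.piEquivPiSubtypeProd (· ∈ X ∪ Y) d).symm (u p, z.2)) id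
  have hA : ∀ ρ, krausMap A ρ = (marginal W (X ∪ Y) ρ).submatrix u u := fun ρ => by
    ext p q
    simp only [marginal, LinearMap.comp_apply, partialTrace, LinearMap.coe_mk, AddHom.coe_mk,
      of_apply, submatrix_apply, hK, krausMap_apply, Matrix.sum_apply]
    rw [Fintype.sum_prod_type_right]
    rfl
  obtain ⟨ρ₀, -, hρ₀⟩ := hX
  have hR : ∀ ρ, traceRight (krausMap A ρ) = marginal W X ρ := fun ρ => by
    rw [hA]; exact traceRight_partialTrace_union h _
  have hL : traceLeft (krausMap A σ) = marginal W Y σ := by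
    rw [hA]; exact traceLeft_partialTrace_union h _
  rw [← hL]
  refine entropy_le_of_reversible_of_vanishing (hXY.submatrix u hA) (ρ₀ := ρ₀)
    (fun ρ hρ => (hR ρ).trans (hρ₀ ρ hρ)) hσ ?_
  rw [← trace_traceRight, hR]
  exact (partialTrace_mem X (hW.isQuantumOperation.map_mem hσ)).2

end Schemes
end QSS

end

/-! ### Averaging over sets of L shares. -/

theorem theorem4 {a : Type*} [Fintype a] [DecidableEq a] {n k L : ℕ} (hL : 1 ≤ L)
    {d : Fin n → Type*} [∀ i, Fintype (d i)] [∀ i, DecidableEq (d i)]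
    (W : Matrix a a ℂ →ₗ[ℂ] Matrix (∀ i, d i) (∀ i, d i) ℂ) (hW : QSS.IsRampScheme k L W)
    (μ : MeasureTheory.Measure (QSS.pureStates a)) [MeasureTheory.IsProbabilityMeasure μ]
    [μ.IsOpenPosMeasure] :
    1 / (L : ℝ) * QSS.entropy (QSS.averageState μ) ≤
      1 / (n : ℝ) * ∑ i : Fin n, QSS.entropy (QSS.marginal W {i} (QSS.averageState μ)) := by
  have hσ := QSS.averageState_mem μ
  set σ := QSS.averageState μ
  have hLk : L ≤ k := by
    have := (hW.forbidden_iff ∅).mp hW.toIsScheme.forbidden_empty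
    simp only [Finset.card_empty, Nat.cast_zero] at this
    omega
  have hkn : k ≤ n := by
    simpa using (hW.qualified_iff Finset.univ).mp hW.toIsScheme.qualified_univ
  have hn : NeZero n := ⟨by omega⟩
  have key : ∀ Y : Finset (Fin n), Y.card = L →
      QSS.entropy σ ≤ ∑ i ∈ Y, QSS.entropy (QSS.marginal W {i} σ) := fun Y hY => by
    -- There is room for X since n - L ≥ k - L; the natural subtraction is exact by `hLk`.
    obtain ⟨X, hXY, hX⟩ := Finset.exists_subset_card_eq (s := Yᶜ) (n := k - L) (by
      rw [Finset.card_compl, Fintype.card_fin, hY]; omega)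
    have hdis : Disjoint X Y := Finset.disjoint_left.mpr fun i hi =>
      Finset.mem_compl.mp (hXY hi)
    refine (QSS.entropy_le_entropy_marginal hW.toIsScheme hdis ((hW.forbidden_iff X).mpr ?_)
      ((hW.qualified_iff _).mpr ?_) hσ).trans
      (QSS.entropy_partialTrace_le_sum (hW.isQuantumOperation.map_mem hσ) Y)
    · rw [hX]; omega
    · rw [Finset.card_union_of_disjoint hdis, hX, hY]; omega
  obtain ⟨T, -, hT⟩ := Finset.exists_subset_card_eq (s := (Finset.univ : Finset (Fin n))) (n := L)
    (by simpa using hLk.trans hkn)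
  have hsum : (n : ℝ) * QSS.entropy σ ≤
      L * ∑ i : Fin n, QSS.entropy (QSS.marginal W {i} σ) := by
    calc (n : ℝ) * QSS.entropy σ = ∑ _j : Fin n, QSS.entropy σ := by simp
      -- Addition in `Fin n` is cyclic, so the n translates of T cover each share exactly L times.
      _ ≤ ∑ j : Fin n, ∑ t ∈ T, QSS.entropy (QSS.marginal W {j + t} σ) :=
        Finset.sum_le_sum fun j _ => by
          have := key (T.map (Equiv.addLeft j).toEmbedding) (by simpa using hT)
          rw [Finset.sum_map] at this
          exact this
      _ = ∑ t ∈ T, ∑ j : Fin n, QSS.entropy (QSS.marginal W {j} σ) := by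
        rw [Finset.sum_comm]
        refine Finset.sum_congr rfl fun t _ => ?_
        exact Equiv.sum_comp (Equiv.addRight t) fun j => QSS.entropy (QSS.marginal W {j} σ)
      _ = _ := by simp [hT]
  have hL0 : (0 : ℝ) < L := by exact_mod_cast hL
  have hn0 : (0 : ℝ) < n := by exact_mod_cast Nat.pos_of_ne_zero hn.ne
  rw [one_div_mul_eq_div, one_div_mul_eq_div, div_le_div_iff₀ hL0 hn0]
  linarith
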